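/- Let $(X,\tau)$ be an uncountable Polish space, let $1\le\xi<\omega_1$, and let $f:X\to\mathbb R$ be a function of Baire class $\xi$ (Baire class $0$ means continuous; for $\xi>0$, Baire class $\xi$ means pointwise limit of a sequence $(f_n)$ with $f_n$ of Baire class $\xi_n$ for some $\xi_n<\xi$). *The rank $\alpha_\xi$.* For an ordinal $\lambda$, consider sequences $(F_\eta)_{\eta<\lambda}$ of $\boldsymbol\Pi^0_\xi(\tau)$ subsets of $X$ that are decreasing (not necessarily strictly), satisfy $F_0=X$, and are continuous: $F_\eta=\bigcap_{\theta<\eta}F_\theta$ for every limit $\eta<\lambda$, and $\bigcap_{\eta<\lambda}F_\eta=\emptyset$ if $\lambda$ is a limit. Put $F_\eta=\emptyset$ for $\eta\ge\lambda$. The transfinite difference of the sequence is $\bigcup_{\eta<\lambda,\ \eta\text{ even}}(F_\eta\setminus F_{\eta+1})$. For $A,B\subseteq X$ let $\alpha_\xi(A,B)$ be the least length $\lambda$ of such a sequence whose transfinite difference contains $A$ and is disjoint from $B$ (and $\omega_1$ if there is no such sequence), and let $$\alpha_\xi(f)=\sup_{p<q,\ p,q\in\mathbb Q}\alpha_\xi(\{f\le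 p\},\{f\ge q\}).$$ *The rank $\alpha^*_\xi$.* For a Polish topology $\tau'$ on $X$ and $A,B\subseteq X$ put $D_{A,B}(F)=\overline{F\cap A}\cap\overline{F\cap B}$ (closures in $\tau'$), and let $D_{A,B}^0(X)=X$, $D_{A,B}^{\eta+1}(X)=D_{A,B}(D_{A,B}^\eta(X))$, and $D_{A,B}^\eta(X)=\bigcap_{\theta<\eta}D_{A,B}^\theta(X)$ for limit $\eta$. Let $\operatorname{rk}(D_{A,B})$ be the least $\eta$ with $D_{A,B}^\eta(X)=\emptyset$ if there is one, and $\omega_1$ otherwise; let $\alpha_{\tau'}(f)=\sup_{p<q,\ p,q\in\mathbb Q}\operatorname{rk}(D_{\{f\le p\},\{f\ge q\}})$. Let $T_{f,\xi}$ be the set of Polish topologies $\tau'\supseteq\tau$ on $X$ with $\tau'\subseteq\boldsymbol\Sigma^0_\xi(\tau)$ for which $f$ is of Baire class $1$ with respect to $\tau'$, and let $\alpha^*_\xi(f)=\min_{\tau'\in T_{f,\xi}}\alpha_{\tau'}(f)$. For ordinals $\theta,\theta'$ write $\theta\lesssim\theta'$ if for every $1\le\eta<\omega_1$, $\theta'\le\omega^\eta$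 implies $\theta\le\omega^\eta$ (ordinal exponentiation), and $\theta\approx\theta'$ if $\theta\lesssim\theta'$ and $\theta'\lesssim\theta$. **Theorem.** The set $T_{f,\xi}$ is non-empty, $\alpha_\xi(f)<\omega_1$ (so both ranks are well defined countable ordinals), and $$\alpha^*_\xi(f)\le\alpha_\xi(f)\le 2\,\alpha^*_\xi(f),\qquad\text{hence}\qquad \alpha^*_\xi(f)\approx\alpha_\xi(f),$$ where $2\theta$ denotes the ordinal product $2\cdot\theta$, i.e. the order type of $\theta$ copies of $2$ (so $2\cdot\omega=\omega$). -/

import Mathlib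

open scoped Ordinal Topology

namespace BaireRank

universe u

variable {X : Type u}

/-- The additive Borel class `Σ⁰_ξ` of the topology `τ` (meaningful for `ξ ≥ 1`, empty for `ξ = 0`):
the class `Σ⁰_1` consists of the open sets and, for `ξ > 1`, the class `Σ⁰_ξ` consists of the
countable unions of sets whose complements are in `Σ⁰_η` for some `η < ξ` that may vary. -/
inductive IsSigma0 (τ : TopologicalSpace X) : Ordinal.{0} → Set X → Prop
  | isOpen (U : Set X) (hU : IsOpen[τ] U) : IsSigma0 τ 1 U
  | iUnion (ξ : Ordinal.{0}) (hξ : 1 < ξ) (η : ℕ → Ordinal.{0}) (A : ℕ → Set X)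
      (hη : ∀ n, η n < ξ) (hA : ∀ n, IsSigma0 τ (η n) (A n)ᶜ) : IsSigma0 τ ξ (⋃ n, A n)

/-- The multiplicative Borel class `Π⁰_ξ` of the topology `τ`. -/
def IsPi0 (τ : TopologicalSpace X) (ξ : Ordinal.{0}) (A : Set X) : Prop :=
  IsSigma0 τ ξ Aᶜ

/-- `f : X → ℝ` is of Baire class `ξ` with respect to `τ`: class `0` means continuous and, for
`ξ > 0`, class `ξ` means pointwise limit of a sequence `g n` where `g n` is of some Baire class
`s n < ξ`. -/
inductive IsBaireClass (τ : TopologicalSpace X) : Ordinal.{0} → (X → ℝ) → Prop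
  | continuous (f : X → ℝ) (hf : @Continuous X ℝ τ _ f) : IsBaireClass τ 0 f
  | lim (ξ : Ordinal.{0}) (s : ℕ → Ordinal.{0}) (g : ℕ → X → ℝ) (f : X → ℝ)
      (hs : ∀ n, s n < ξ) (hg : ∀ n, IsBaireClass τ (s n) (g n))
      (hlim : ∀ x, Filter.Tendsto (fun n => g n x) Filter.atTop (nhds (f x))) :
      IsBaireClass τ ξ f

/-! ### The rank `α` on the Baire class 1 functions -/

/-- The derivative `D_{A,B}(F)`, the intersection of the `τ`-closures of `F ∩ A` and `F ∩ B`. -/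
def deriv (τ : TopologicalSpace X) (A B F : Set X) : Set X :=
  @closure X τ (F ∩ A) ∩ @closure X τ (F ∩ B)

/-- The iterated derivatives `D^η(F)` of an operation `D`, with intersections at limit stages. -/
noncomputable def iterDeriv (D : Set X → Set X) (F : Set X) (η : Ordinal.{0}) : Set X :=
  Ordinal.limitRecOn η F (fun _ S => D S) (fun o _ S => ⋂ (θ : Ordinal.{0}) (h : θ < o), S θ h)

theorem iterDeriv_zero (D : Set X → Set X) (F : Set X) : iterDeriv D F 0 = F := by
  simp [iterDeriv]

theorem iterDeriv_add_one (D : Set X → Set X) (F : Set X) (η : Ordinal.{0}) :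
    iterDeriv D F (η + 1) = D (iterDeriv D F η) := by
  simp [iterDeriv]

theorem iterDeriv_limit (D : Set X → Set X) (F : Set X) {η : Ordinal.{0}}
    (h : Order.IsSuccLimit η) :
    iterDeriv D F η = ⋂ (θ : Ordinal.{0}) (_ : θ < η), iterDeriv D F θ := by
  unfold iterDeriv
  rw [Ordinal.limitRecOn_limit _ _ _ _ h]

open Classical in
/-- The rank of a derivative `D`: the least `η` with `D^η(X) = ∅` if there is one, `ω₁` if not. -/
noncomputable def derivRank (D : Set X → Set X) : Ordinal.{0} :=
  if ∃ η, iterDeriv D Set.univ η = ∅ then sInf {η | iterDeriv D Set.univ η = ∅} else ω₁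

/-- Pairs of rationals `p < q`. -/
abbrev RatPair : Type := {r : ℚ × ℚ // r.1 < r.2}

/-- The separation rank `α_τ(f)`, the supremum over rationals `p < q` of the rank of `D_{A,B}`
for `A = {f ≤ p}` and `B = {f ≥ q}`. -/
noncomputable def alpha (τ : TopologicalSpace X) (f : X → ℝ) : Ordinal.{0} :=
  ⨆ r : RatPair, derivRank (deriv τ {x | f x ≤ (r.1.1 : ℝ)} {x | (r.1.2 : ℝ) ≤ f x})

/-! ### Transfinite differences and the rank `α_ξ` -/

/-- `(F η)_{η < l}` is a decreasing continuous sequence of length `l` starting with the whole space,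
extended by `F η = ∅` for `η ≥ l`. -/
structure IsDecrContSeq (l : Ordinal.{0}) (F : Ordinal.{0} → Set X) : Prop where
  zero : F 0 = Set.univ
  antitone : ∀ θ η, θ ≤ η → η < l → F η ⊆ F θ
  continuous : ∀ η, η < l → Order.IsSuccLimit η → F η = ⋂ (θ : Ordinal.{0}) (_ : θ < η), F θ
  limit_length : Order.IsSuccLimit l → ⋂ (η : Ordinal.{0}) (_ : η < l), F η = ∅
  eq_empty : ∀ η, l ≤ η → F η = ∅

/-- Even ordinals, that is, ordinals `λ + 2n` with `λ` zero or limit and `n` finite; these are the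
ordinals of the form `2 · ζ`, the order type of `ζ` copies of `2`. -/
def IsEvenOrdinal (η : Ordinal.{0}) : Prop := ∃ ζ : Ordinal.{0}, η = 2 * ζ

/-- The transfinite difference of `(F η)_{η < l}`: the union of `F η \ F (η + 1)` over even
`η < l`. -/
def transDiff (l : Ordinal.{0}) (F : Ordinal.{0} → Set X) : Set X :=
  ⋃ (η : Ordinal.{0}) (_ : η < l) (_ : IsEvenOrdinal η), F η \ F (η + 1)

/-- `A` can be separated from `B` by the transfinite difference of a decreasing continuous
sequence of `Π⁰_ξ(τ)` sets of length `l`. -/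
def SeparatedByDiff (τ : TopologicalSpace X) (ξ : Ordinal.{0}) (A B : Set X) (l : Ordinal.{0}) :
    Prop :=
  ∃ F : Ordinal.{0} → Set X, IsDecrContSeq l F ∧ (∀ η, η < l → IsPi0 τ ξ (F η)) ∧
    A ⊆ transDiff l F ∧ Disjoint (transDiff l F) B

open Classical in
/-- `α_ξ(A, B)`: the length of the shortest sequence of `Π⁰_ξ` sets whose transfinite difference
separates `A` from `B` (and `ω₁` if there is no such sequence). -/
noncomputable def alphaXiSets (τ : TopologicalSpace X) (ξ : Ordinal.{0}) (A B : Set X) :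
    Ordinal.{0} :=
  if ∃ l, SeparatedByDiff τ ξ A B l then sInf {l | SeparatedByDiff τ ξ A B l} else ω₁

/-- The separation rank `α_ξ(f)`. -/
noncomputable def alphaXi (τ : TopologicalSpace X) (ξ : Ordinal.{0}) (f : X → ℝ) : Ordinal.{0} :=
  ⨆ r : RatPair, alphaXiSets τ ξ {x | f x ≤ (r.1.1 : ℝ)} {x | (r.1.2 : ℝ) ≤ f x}

/-! ### The rank `α*_ξ` -/

/-- `T_{f,ξ}`: the Polish topologies `τ'` with `τ ⊆ τ' ⊆ Σ⁰_ξ(τ)` for which `f` is of Baire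
class `1`. -/
def refinements (τ : TopologicalSpace X) (ξ : Ordinal.{0}) (f : X → ℝ) :
    Set (TopologicalSpace X) :=
  {τ' | (∀ U : Set X, IsOpen[τ] U → IsOpen[τ'] U) ∧ @PolishSpace X τ' ∧
    (∀ U : Set X, IsOpen[τ'] U → IsSigma0 τ ξ U) ∧ IsBaireClass τ' 1 f}

/-- `α*_ξ(f)`, the minimum of `α_{τ'}(f)` over `τ' ∈ T_{f,ξ}`. -/
noncomputable def alphaStar (τ : TopologicalSpace X) (ξ : Ordinal.{0}) (f : X → ℝ) :
    Ordinal.{0} :=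
  sInf ((fun τ' => alpha τ' f) '' refinements τ ξ f)

/-! ### Essential comparison of countable ordinals -/

/-- `θ ≲ θ'`: for all `1 ≤ η < ω₁`, if `θ' ≤ ω ^ η` then `θ ≤ ω ^ η`. -/
def EssLE (θ θ' : Ordinal.{0}) : Prop :=
  ∀ η : Ordinal.{0}, 1 ≤ η → η < ω₁ → θ' ≤ ω ^ η → θ ≤ ω ^ η

/-- `θ ≈ θ'`. -/
def EssEq (θ θ' : Ordinal.{0}) : Prop := EssLE θ θ' ∧ EssLE θ' θ

end BaireRank

/-! Both inequalities come from comparing closed sets of a finer topology with `Π⁰_ξ` sets of `τ`.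

Upper bound: for `τ' ∈ T_{f,ξ}`, every `τ'`-closed set is `Π⁰_ξ(τ)`. The iterated derivatives `D^ζ`,
interleaved with the closures of `D^ζ ∩ B`, form a sequence twice as long as the derivation, and its
transfinite difference separates `A` from `B`. So `α_ξ(f) ≤ 2 · α_{τ'}(f)` for every such `τ'`.
Baire category makes `D` shrink nonempty closed sets strictly, and second countability then makes
the bound countable.

Lower bound: optimal separating sequences for all rational pairs involve only countably many `Π⁰_ξ`
sets. Some `τ' ∈ T_{f,ξ}` makes them all closed, and then `D^η ⊆ F_η` by induction
(`iterDeriv_subset_of_separated`), so `α_{τ'}(f) ≤ α_ξ(f)`. Such refinements come from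
`exists_polishSpace_forall_isOpen`. Finally `2 · ω^η = ω^η` for `η ≥ 1` gives `≈`. -/

namespace BaireRank

/-! ### Countable ordinals -/

theorem lt_omega_one_iff_countable {o : Ordinal.{0}} : o < ω₁ ↔ (Set.Iio o).Countable := by
  rw [← Cardinal.ord_aleph, Cardinal.lt_ord, ← Cardinal.le_aleph0_iff_set_countable,
    Cardinal.mk_Iio_ordinal, Cardinal.lift_le_aleph0, ← Order.lt_succ_iff, Cardinal.succ_aleph0]

theorem mul_lt_omega_one {a b : Ordinal.{0}} (ha : a < ω₁) (hb : b < ω₁) : a * b < ω₁ := by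
  rw [← Cardinal.ord_aleph, Cardinal.lt_ord] at *
  rw [Ordinal.card_mul]
  exact Cardinal.mul_lt_of_lt (Cardinal.aleph0_le_aleph 1) ha hb

theorem two_mul_omega0_opow {η : Ordinal.{0}} (h : 1 ≤ η) : 2 * ω ^ η = ω ^ η := by
  rw [← Ordinal.add_sub_cancel_of_le h, Ordinal.opow_add, Ordinal.opow_one, ← mul_assoc,
    Ordinal.mul_omega0 two_pos (by exact_mod_cast Ordinal.natCast_lt_omega0 2)]

theorem essEq_of_le_of_le_two_mul {a b : Ordinal.{0}} (h : a ≤ b) (h' : b ≤ 2 * a) : EssEq a b :=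
  ⟨fun _ _ _ hb => h.trans hb, fun _ h1 _ ha =>
    h'.trans ((mul_le_mul_right ha 2).trans_eq (two_mul_omega0_opow h1))⟩

theorem two_mul_add_one_mod_two (ζ : Ordinal.{0}) : (2 * ζ + 1) % 2 = 1 := by
  rw [Ordinal.mul_add_mod_self, Ordinal.mod_eq_of_lt one_lt_two]

theorem two_mul_add_one_div_two (ζ : Ordinal.{0}) : (2 * ζ + 1) / 2 = ζ := by
  rw [Ordinal.mul_add_div _ two_ne_zero, Ordinal.div_eq_zero_of_lt one_lt_two, add_zero]

theorem mod_two_eq (η : Ordinal.{0}) : η % 2 = 0 ∨ η % 2 = 1 := by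
  have h := Ordinal.mod_lt η (two_ne_zero (α := Ordinal.{0}))
  have h1 : η % 2 ≤ 1 := by
    rwa [← Order.lt_succ_iff, Order.succ_eq_add_one, one_add_one_eq_two]
  rcases h1.lt_or_eq with h | h
  exacts [.inl (Order.lt_one_iff.1 h), .inr h]

theorem exists_isSuccLimit_eq_two_mul {η : Ordinal.{0}} (h : Order.IsSuccLimit η) :
    ∃ ζ, Order.IsSuccLimit ζ ∧ η = 2 * ζ := by
  have hη := Ordinal.div_add_mod η 2
  rcases mod_two_eq η with h0 | h0
  · rw [h0, add_zero] at hη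
    refine ⟨η / 2, ?_, hη.symm⟩
    rcases Ordinal.zero_or_succ_or_isSuccLimit (η / 2) with hz | ⟨k, hk⟩ | hl
    · rw [hz, mul_zero] at hη
      exact absurd hη.symm h.ne_bot
    · rw [← hk, Order.succ_eq_add_one, mul_add, mul_one, ← one_add_one_eq_two, ← add_assoc] at hη
      rw [← hη, ← Order.succ_eq_add_one] at h
      exact absurd h (Order.not_isSuccLimit_succ _)
    · exact hl
  · rw [h0] at hη
    rw [← hη, ← Order.succ_eq_add_one] at h
    exact absurd h (Order.not_isSuccLimit_succ _)

/-! ### Pointwise limits -/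

/-- Weak inequalities survive the limit, and the margin `1 / (k + 1)` restores strictness. The
complements match the shape of `IsSigma0.iUnion`. -/
theorem setOf_lt_eq_iUnion {Y : Type*} {g : ℕ → Y → ℝ} {f : Y → ℝ}
    (hlim : ∀ x, Filter.Tendsto (fun n => g n x) Filter.atTop (𝓝 (f x))) (c : ℝ) :
    {x | c < f x} = ⋃ (k : ℕ) (N : ℕ), ⋂ (n : ℕ) (_ : N ≤ n), {x | g n x < c + 1 / (k + 1)}ᶜ := by
  ext x
  simp only [Set.mem_ofPred_eq, Set.mem_iUnion, Set.mem_iInter, Set.mem_compl_iff, not_lt]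
  constructor
  · intro h
    obtain ⟨k, hk⟩ := exists_nat_one_div_lt (sub_pos.2 h)
    obtain ⟨N, hN⟩ := Filter.eventually_atTop.1
      ((hlim x).eventually (lt_mem_nhds (lt_sub_iff_add_lt'.1 hk)))
    exact ⟨k, N, fun n hn => (hN n hn).le⟩
  · rintro ⟨k, N, h⟩
    exact (lt_add_of_pos_right c Nat.one_div_pos_of_nat).trans_le
      (ge_of_tendsto (hlim x) (Filter.eventually_atTop.2 ⟨N, h⟩))

/-! ### Ranks as least elements -/

theorem derivRank_le {Y : Type*} {D : Set Y → Set Y} {η : Ordinal.{0}}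
    (h : iterDeriv D Set.univ η = ∅) :
    derivRank D ≤ η := by
  rw [derivRank, if_pos ⟨η, h⟩]
  exact csInf_le' h

theorem iterDeriv_derivRank {Y : Type*} {D : Set Y → Set Y} (h : ∃ η, iterDeriv D Set.univ η = ∅) :
    iterDeriv D Set.univ (derivRank D) = ∅ := by
  rw [derivRank, if_pos h]
  exact csInf_mem (s := {η | iterDeriv D Set.univ η = ∅}) h

theorem alphaXiSets_le {Y : Type*} {τ : TopologicalSpace Y} {ξ : Ordinal.{0}} {A B : Set Y}
    {l : Ordinal.{0}}
    (h : SeparatedByDiff τ ξ A B l) : alphaXiSets τ ξ A B ≤ l := by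
  rw [alphaXiSets, if_pos ⟨l, h⟩]
  exact csInf_le' h

theorem separatedByDiff_alphaXiSets {Y : Type*} {τ : TopologicalSpace Y} {ξ : Ordinal.{0}}
    {A B : Set Y}
    (h : ∃ l, SeparatedByDiff τ ξ A B l) : SeparatedByDiff τ ξ A B (alphaXiSets τ ξ A B) := by
  rw [alphaXiSets, if_pos h]
  exact csInf_mem (s := {l | SeparatedByDiff _ ξ A B l}) h

/-! ### Additive Borel classes -/

universe u

variable {X : Type u} [τ : TopologicalSpace X]

theorem isSigma0_iff {ξ : Ordinal.{0}} {U : Set X} :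
    IsSigma0 τ ξ U ↔ (ξ = 1 ∧ IsOpen U) ∨ (1 < ξ ∧ ∃ (η : ℕ → Ordinal.{0}) (A : ℕ → Set X),
      (∀ n, η n < ξ) ∧ (∀ n, IsSigma0 τ (η n) (A n)ᶜ) ∧ U = ⋃ n, A n) := by
  constructor
  · rintro (⟨U, hU⟩ | ⟨ξ, hξ, η, A, hη, hA⟩)
    · exact .inl ⟨rfl, hU⟩
    · exact .inr ⟨hξ, η, A, hη, hA, rfl⟩
  · rintro (⟨rfl, hU⟩ | ⟨hξ, η, A, hη, hA, rfl⟩)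
    · exact .isOpen U hU
    · exact .iUnion ξ hξ η A hη hA

theorem isSigma0_one_iff {U : Set X} : IsSigma0 τ 1 U ↔ IsOpen U := by
  rw [isSigma0_iff]
  simp

theorem IsSigma0.one_le {ξ : Ordinal.{0}} {U : Set X} (h : IsSigma0 τ ξ U) : 1 ≤ ξ := by
  rcases isSigma0_iff.1 h with ⟨rfl, -⟩ | ⟨h, -⟩
  exacts [le_rfl, h.le]

theorem IsSigma0.of_compl {η ξ : Ordinal.{0}} {A : Set X} (h : IsSigma0 τ η Aᶜ) (hη : η < ξ) :
    IsSigma0 τ ξ A := by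
  rw [← Set.iUnion_const (ι := ℕ) A]
  exact .iUnion ξ (h.one_le.trans_lt hη) (fun _ => η) _ (fun _ => hη) fun _ => h

theorem IsSigma0.iUnion_nat {ξ : Ordinal.{0}} {A : ℕ → Set X} (h : ∀ n, IsSigma0 τ ξ (A n)) :
    IsSigma0 τ ξ (⋃ n, A n) := by
  rcases (h 0).one_le.eq_or_lt with rfl | hξ
  · simp_rw [isSigma0_one_iff] at *
    exact isOpen_iUnion h
  · have h' := fun n => ((isSigma0_iff.1 (h n)).resolve_left fun h => hξ.ne' h.1).2
    choose η B hη hB hAB using h'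
    have : ⋃ n, A n = ⋃ n : ℕ, B n.unpair.1 n.unpair.2 := by
      simp_rw [hAB]
      exact (Set.iUnion_unpair _).symm
    rw [this]
    exact .iUnion ξ hξ (fun n => η n.unpair.1 n.unpair.2) _ (fun n => hη _ _) fun n => hB _ _

section Metrizable

variable [TopologicalSpace.MetrizableSpace X]

theorem _root_.IsOpen.isSigma0 {ξ : Ordinal.{0}} {U : Set X} (hU : IsOpen U) (hξ : 1 ≤ ξ) :
    IsSigma0 τ ξ U := by
  rcases hξ.eq_or_lt with rfl | hξ
  · exact .isOpen U hU
  · let := TopologicalSpace.metrizableSpaceMetric X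
    obtain ⟨F, hF, -, rfl, -⟩ := hU.exists_iUnion_isClosed
    exact .iUnion ξ hξ (fun _ => 1) F (fun _ => hξ) fun n => .isOpen _ (hF n).isOpen_compl

theorem IsSigma0.mono {η ξ : Ordinal.{0}} {U : Set X} (h : IsSigma0 τ η U) (hη : η ≤ ξ) :
    IsSigma0 τ ξ U := by
  rcases isSigma0_iff.1 h with ⟨rfl, hU⟩ | ⟨h1, s, A, hs, hA, rfl⟩
  · exact hU.isSigma0 hη
  · exact .iUnion ξ (h1.trans_le hη) s A (fun n => (hs n).trans_le hη) hA

theorem IsSigma0.biUnion {ι : Type*} {ξ : Ordinal.{0}} (hξ : 1 ≤ ξ) {s : Set ι} (hs : s.Countable)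
    {A : ι → Set X} (h : ∀ i ∈ s, IsSigma0 τ ξ (A i)) : IsSigma0 τ ξ (⋃ i ∈ s, A i) := by
  rcases s.eq_empty_or_nonempty with rfl | hne
  · simpa using isOpen_empty.isSigma0 hξ
  · obtain ⟨g, rfl⟩ := hs.exists_eq_range hne
    rw [Set.biUnion_range]
    exact .iUnion_nat fun n => h _ ⟨n, rfl⟩

theorem IsSigma0.iUnion_countable {ι : Type*} [Countable ι] {ξ : Ordinal.{0}} (hξ : 1 ≤ ξ)
    {A : ι → Set X} (h : ∀ i, IsSigma0 τ ξ (A i)) : IsSigma0 τ ξ (⋃ i, A i) := by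
  rw [← Set.biUnion_univ]
  exact .biUnion hξ Set.countable_univ fun i _ => h i

theorem IsSigma0.union {ξ : Ordinal.{0}} {A B : Set X} (hA : IsSigma0 τ ξ A)
    (hB : IsSigma0 τ ξ B) : IsSigma0 τ ξ (A ∪ B) := by
  rw [Set.union_eq_iUnion]
  exact .iUnion_countable hA.one_le (by rintro (_ | _) <;> assumption)

theorem IsSigma0.inter {ξ : Ordinal.{0}} {A B : Set X} (hA : IsSigma0 τ ξ A)
    (hB : IsSigma0 τ ξ B) : IsSigma0 τ ξ (A ∩ B) := by
  rcases hA.one_le.eq_or_lt with rfl | hξ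
  · simp_rw [isSigma0_one_iff] at *
    exact hA.inter hB
  · obtain ⟨-, a, A, ha, hA', rfl⟩ := (isSigma0_iff.1 hA).resolve_left fun h => hξ.ne' h.1
    obtain ⟨-, b, B, hb, hB', rfl⟩ := (isSigma0_iff.1 hB).resolve_left fun h => hξ.ne' h.1
    simp_rw [Set.iUnion_inter, Set.inter_iUnion]
    refine .iUnion_nat fun n => .iUnion_nat fun m => ?_
    refine IsSigma0.of_compl (η := max (a n) (b m)) ?_ (max_lt (ha _) (hb _))
    rw [Set.compl_inter]
    exact ((hA' _).mono (le_max_left _ _)).union ((hB' _).mono (le_max_right _ _))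

theorem IsSigma0.sInter {ξ : Ordinal.{0}} (hξ : 1 ≤ ξ) {S : Set (Set X)} (hS : S.Finite)
    (h : ∀ U ∈ S, IsSigma0 τ ξ U) : IsSigma0 τ ξ (⋂₀ S) := by
  induction S, hS using Set.Finite.induction_on with
  | empty => simpa using isOpen_univ.isSigma0 hξ
  | insert _ _ ih =>
    rw [Set.sInter_insert]
    exact (h _ (Set.mem_insert _ _)).inter (ih fun U hU => h U (Set.mem_insert_of_mem _ hU))

/-- Second countability of the generated topology reduces an arbitrary union of finite intersections
from `S` to a countable one. -/
theorem isSigma0_of_isOpen_generateFrom {ξ : Ordinal.{0}} (hξ : 1 ≤ ξ) {S : Set (Set X)}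
    (hc : @SecondCountableTopology X (.generateFrom S)) (hS : ∀ U ∈ S, IsSigma0 τ ξ U)
    {U : Set X} (hU : IsOpen[.generateFrom S] U) : IsSigma0 τ ξ U := by
  have hb := @TopologicalSpace.isTopologicalBasis_of_subbasis X (.generateFrom S) S rfl
  obtain ⟨B, hB, rfl⟩ := @TopologicalSpace.IsTopologicalBasis.open_eq_sUnion X (.generateFrom S)
    _ hb U hU
  obtain ⟨T, hT, hTB, hTU⟩ := @TopologicalSpace.isOpen_sUnion_countable X (.generateFrom S) hc B
    fun s hs => @TopologicalSpace.IsTopologicalBasis.isOpen X (.generateFrom S) _ _ hb (hB hs)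
  rw [← hTU, Set.sUnion_eq_biUnion]
  refine .biUnion hξ hT fun V hV => ?_
  obtain ⟨W, ⟨hW, hWS⟩, rfl⟩ := hB (hTB hV)
  exact .sInter hξ hW fun U hU => hS U (hWS hU)

end Metrizable

/-! ### Refinements of Polish topologies -/

/-- A closed set of a Polish space can be made open in a finer Polish topology, whose open sets
are the sets `(V ∩ A) ∪ (W ∩ Aᶜ)` with `V` and `W` open. -/
theorem exists_polishSpace_isOpen_of_isClosed [PolishSpace X] {A : Set X} (hA : IsClosed A) :
    ∃ τ' ≤ τ, @PolishSpace X τ' ∧ IsOpen[τ'] A ∧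
      ∀ U, IsOpen[τ'] U → ∃ V W, IsOpen V ∧ IsOpen W ∧ U = (V ∩ A) ∪ (W ∩ Aᶜ) := by
  classical
  have : PolishSpace A := hA.polishSpace
  have : PolishSpace ↑Aᶜ := hA.isOpen_compl.polishSpace
  -- The new topology is that of the disjoint sum of `A` and `Aᶜ`, both Polish as subspaces.
  let f : A ⊕ ↑Aᶜ ≃ X := Equiv.Set.sumCompl A
  have hle : TopologicalSpace.coinduced f instTopologicalSpaceSum ≤ τ := by
    simp only [instTopologicalSpaceSum, coinduced_sup, coinduced_compose, sup_le_iff,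
      ← continuous_iff_coinduced_le]
    exact ⟨continuous_subtype_val, continuous_subtype_val⟩
  refine ⟨.coinduced f instTopologicalSpaceSum, hle, ?_, ?_, ?_⟩
  · rw [← f.induced_symm]
    exact f.symm.polishSpace_induced
  · rw [isOpen_coinduced, isOpen_sum_iff]
    simp [Set.preimage_preimage, f]
  · intro U hU
    rw [isOpen_coinduced, isOpen_sum_iff] at hU
    obtain ⟨V, hV, hVU⟩ := isOpen_induced_iff.1 hU.1
    obtain ⟨W, hW, hWU⟩ := isOpen_induced_iff.1 hU.2
    refine ⟨V, W, hV, hW, ?_⟩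
    ext x
    by_cases hx : x ∈ A
    · have := congrArg (⟨x, hx⟩ ∈ ·) hVU
      simpa [f, hx, eq_comm] using this
    · have := congrArg (⟨x, hx⟩ ∈ ·) hWU
      simpa [f, hx, eq_comm] using this

/-- Induction on `ξ`: each `C i` is a union of sets `A i n` whose complements have lower class. Open
up `(A i n)ᶜ` by induction, so that `A i n` is closed, then split the space along `A i n`. The
topologies obtained are joined at the end. -/
theorem exists_polishSpace_forall_isOpen [PolishSpace X] {ι : Type*} [Countable ι]
    {ξ : Ordinal.{0}} (hξ : 1 ≤ ξ) {C : ι → Set X}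
    (hC : ∀ i, IsSigma0 τ ξ (C i)) :
    ∃ τ' ≤ τ, @PolishSpace X τ' ∧ (∀ U, IsOpen[τ'] U → IsSigma0 τ ξ U) ∧
      ∀ i, IsOpen[τ'] (C i) := by
  induction ξ using WellFoundedLT.induction generalizing ι with
  | ind ξ ih =>
  rcases hξ.eq_or_lt with rfl | hξ1
  · exact ⟨τ, le_rfl, ‹_›, fun U hU => .isOpen U hU, fun i => isSigma0_one_iff.1 (hC i)⟩
  have hC' := fun i => ((isSigma0_iff.1 (hC i)).resolve_left fun h => hξ1.ne' h.1).2
  choose η A hη hA hCA using hC'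
  have step : ∀ p : ι × ℕ, ∃ τ' ≤ τ, @PolishSpace X τ' ∧ IsOpen[τ'] (A p.1 p.2) ∧
      ∀ U, IsOpen[τ'] U → IsSigma0 τ ξ U := by
    rintro ⟨i, n⟩
    have key : ∀ V W, IsSigma0 τ (η i n) V → IsSigma0 τ (η i n) W →
        IsSigma0 τ ξ (V ∩ A i n ∪ W ∩ (A i n)ᶜ) := fun V W hV hW =>
      ((hV.mono (hη i n).le).inter (.of_compl (hA i n) (hη i n))).union
        ((hW.inter (hA i n)).mono (hη i n).le)
    obtain ⟨τ₁, hle, hP, hS, hO⟩ := ih (η i n) (hη i n) (ι := PUnit) (hA i n).one_le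
      (C := fun _ => (A i n)ᶜ) fun _ => hA i n
    obtain ⟨τ₂, hle₂, hP₂, hO₂, hS₂⟩ := @exists_polishSpace_isOpen_of_isClosed X τ₁ hP (A i n)
      (@isOpen_compl_iff X (A i n) τ₁ |>.1 (hO ⟨⟩))
    refine ⟨τ₂, hle₂.trans hle, hP₂, hO₂, fun U hU => ?_⟩
    obtain ⟨V, W, hV, hW, rfl⟩ := hS₂ U hU
    exact key V W (hS V hV) (hS W hW)
  choose t hle hP hO hS using step
  -- Adding `τ` itself gives the family a coarsest member, as the Polish join requires, and covers
  -- empty `ι`.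
  let t' : Option (ι × ℕ) → TopologicalSpace X := fun i => i.elim τ t
  have hP' : @PolishSpace X (⨅ i, t' i) :=
    .iInf ⟨none, Option.forall.2 ⟨le_rfl, hle⟩⟩ (Option.forall.2 ⟨‹_›, hP⟩)
  refine ⟨⨅ i, t' i, iInf_le t' none, hP', ?_, fun i => ?_⟩
  · rw [← generateFrom_iUnion_isOpen] at hP' ⊢
    refine fun U hU => isSigma0_of_isOpen_generateFrom hξ hP'.toSecondCountableTopology ?_ hU
    simp only [Set.mem_iUnion, forall_exists_index]
    rintro V (_ | p) hV
    exacts [IsOpen.isSigma0 hV hξ, hS p V hV]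
  · rw [hCA]
    exact @isOpen_iUnion X ℕ (⨅ i, t' i) _ fun n => iInf_le t' (some (i, n)) _ (hO (i, n))

/-! ### Baire classes -/

theorem IsBaireClass.exists_tendsto {ξ : Ordinal.{0}} (hξ : ξ ≠ 0) {f : X → ℝ}
    (hf : IsBaireClass τ ξ f) : ∃ (s : ℕ → Ordinal.{0}) (g : ℕ → X → ℝ), (∀ n, s n < ξ) ∧
      (∀ n, IsBaireClass τ (s n) (g n)) ∧
      ∀ x, Filter.Tendsto (fun n => g n x) Filter.atTop (𝓝 (f x)) := by
  cases hf with
  | continuous _ => exact absurd rfl hξ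
  | lim _ s g _ hs hg hlim => exact ⟨s, g, hs, hg, hlim⟩

theorem IsBaireClass.exists_tendsto_continuous {f : X → ℝ} (hf : IsBaireClass τ 1 f) :
    ∃ g : ℕ → X → ℝ, (∀ n, Continuous (g n)) ∧
      ∀ x, Filter.Tendsto (fun n => g n x) Filter.atTop (𝓝 (f x)) := by
  obtain ⟨s, g, hs, hg, hlim⟩ := hf.exists_tendsto one_ne_zero
  refine ⟨g, fun n => ?_, hlim⟩
  have h := hg n
  rw [Order.lt_one_iff.1 (hs n)] at h
  cases h with
  | continuous _ h => exact h
  | lim _ s g _ hs => exact absurd (hs 0) not_lt_zero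

theorem IsBaireClass.isSigma0_setOf_lt [TopologicalSpace.MetrizableSpace X] {ξ : Ordinal.{0}}
    {f : X → ℝ} (hf : IsBaireClass τ ξ f) (c : ℝ) :
    IsSigma0 τ (ξ + 1) {x | c < f x} ∧ IsSigma0 τ (ξ + 1) {x | f x < c} := by
  induction hf generalizing c with
  | continuous f hf =>
    rw [zero_add]
    exact ⟨.isOpen _ (isOpen_lt continuous_const hf), .isOpen _ (isOpen_lt hf continuous_const)⟩
  | lim ξ s g f hs hg hlim ih =>
    have hξ1 : 1 ≤ ξ := Order.one_le_iff_pos.2 ((zero_le).trans_lt (hs 0))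
    have hsξ : ∀ n, s n + 1 ≤ ξ := fun n => Order.add_one_le_of_lt (hs n)
    have hlt : ξ < ξ + 1 := lt_add_one ξ
    have key : ∀ {g : ℕ → X → ℝ} {f : X → ℝ} (c : ℝ),
        (∀ n c, IsSigma0 τ (s n + 1) {x | g n x < c}) →
        (∀ x, Filter.Tendsto (fun n => g n x) Filter.atTop (𝓝 (f x))) →
        IsSigma0 τ (ξ + 1) {x | c < f x} := by
      intro g f c hg hlim
      rw [setOf_lt_eq_iUnion hlim]
      refine .iUnion_nat fun k => .iUnion_nat fun N => .of_compl ?_ hlt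
      simp only [Set.compl_iInter, compl_compl]
      exact .biUnion hξ1 (Set.to_countable (Set.Ici N)) fun n _ => (hg n _).mono (hsξ n)
    refine ⟨key c (fun n c => (ih n c).2) hlim, ?_⟩
    -- The other half follows by negating `f` and the approximants.
    have := key (g := fun n => -g n) (f := -f) (-c) (fun n c => ?_) fun x => (hlim x).neg
    · simpa using this
    · simpa [neg_lt] using (ih n (-c)).1

/-- A function is continuous as soon as the sets `{c < f}` and `{f < c}` are open for rational
`c`. -/
theorem continuous_of_isOpen_rat {f : X → ℝ} (h : ∀ c : ℚ, IsOpen {x | (c : ℝ) < f x})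
    (h' : ∀ c : ℚ, IsOpen {x | f x < (c : ℝ)}) : Continuous f := by
  refine Real.isTopologicalBasis_Ioo_rat.continuous_iff.2 fun U hU => ?_
  simp only [Set.mem_iUnion, Set.mem_singleton_iff] at hU
  obtain ⟨a, b, -, rfl⟩ := hU
  exact (h a).inter (h' b)

/-- Countably many `Σ⁰_ξ` sets can be made open in a topology in which a given function of Baire
class `ξ` is of Baire class `1`. -/
theorem exists_mem_refinements [PolishSpace X] {ι : Type*} [Countable ι] {ξ : Ordinal.{0}}
    (hξ : 1 ≤ ξ) {f : X → ℝ} (hf : IsBaireClass τ ξ f) {C : ι → Set X}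
    (hC : ∀ i, IsSigma0 τ ξ (C i)) :
    ∃ τ' ∈ refinements τ ξ f, ∀ i, IsOpen[τ'] (C i) := by
  obtain ⟨s, g, hs, hg, hlim⟩ := hf.exists_tendsto (Order.one_le_iff_ne_zero.1 hξ)
  have hsξ : ∀ n, s n + 1 ≤ ξ := fun n => Order.add_one_le_of_lt (hs n)
  -- Besides `C`, open the rational half-line preimages of every `g n`. This makes each `g n`
  -- continuous, hence `f` of class `1`.
  let D : ι ⊕ (ℕ × ℚ) ⊕ (ℕ × ℚ) → Set X := Sum.elim C
    (Sum.elim (fun p => {x | (p.2 : ℝ) < g p.1 x}) fun p => {x | g p.1 x < (p.2 : ℝ)})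
  obtain ⟨τ', hle, hP, hS, hO⟩ := exists_polishSpace_forall_isOpen hξ (C := D) (by
    rintro (i | p | p)
    · exact hC i
    · exact ((hg p.1).isSigma0_setOf_lt _).1.mono (hsξ _)
    · exact ((hg p.1).isSigma0_setOf_lt _).2.mono (hsξ _))
  refine ⟨τ', ⟨fun U hU => hle U hU, hP, hS, ?_⟩, fun i => hO (.inl i)⟩
  refine .lim 1 (fun _ => 0) g f (fun _ => zero_lt_one) (fun n => .continuous _ ?_) hlim
  exact @continuous_of_isOpen_rat X τ' (g n) (fun c => hO (.inr (.inl (n, c))))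
    fun c => hO (.inr (.inr (n, c)))

/-! ### Iterated derivatives -/

theorem deriv_subset_of_isClosed (A B : Set X) {F : Set X} (hF : IsClosed F) :
    deriv τ A B F ⊆ F :=
  Set.inter_subset_left.trans (hF.closure_subset_iff.2 Set.inter_subset_left)

theorem isClosed_iterDeriv (A B : Set X) (η : Ordinal.{0}) :
    IsClosed (iterDeriv (deriv τ A B) Set.univ η) := by
  induction η using Ordinal.limitRecOn with
  | zero => simp [iterDeriv_zero]
  | add_one η _ =>
    rw [iterDeriv_add_one]
    exact isClosed_closure.inter isClosed_closure
  | limit η hη ih =>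
    rw [iterDeriv_limit _ _ hη]
    exact isClosed_biInter ih

theorem antitone_iterDeriv (A B : Set X) : Antitone (iterDeriv (deriv τ A B) Set.univ) := by
  intro θ η h
  induction η using Ordinal.limitRecOn with
  | zero => rw [nonpos_iff_eq_zero.1 h]
  | add_one η ih =>
    rcases h.eq_or_lt with rfl | h
    · rfl
    · rw [iterDeriv_add_one]
      exact (deriv_subset_of_isClosed A B (isClosed_iterDeriv A B η)).trans
        (ih (Order.lt_add_one_iff.1 h))
  | limit η hη ih =>
    rcases h.eq_or_lt with rfl | h
    · rfl
    · rw [iterDeriv_limit _ _ hη]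
      exact Set.biInter_subset_of_mem h

/-- If a derivative strictly shrinks every nonempty closed set, then its iterates reach the empty
set at a countable stage. -/
theorem exists_iterDeriv_eq_empty [SecondCountableTopology X] {A B : Set X}
    (h : ∀ F : Set X, IsClosed F → F.Nonempty → deriv τ A B F ≠ F) :
    ∃ η < ω₁, iterDeriv (deriv τ A B) Set.univ η = ∅ := by
  by_contra! hne
  let E := iterDeriv (deriv τ A B) Set.univ
  -- Each strict drop is witnessed by a basic open set meeting `E η` but not `E (η + 1)`. Distinct
  -- stages get distinct witnesses, so `ω₁` would inject into a countable basis.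
  have hstep : ∀ η : Set.Iio (ω₁ : Ordinal.{0}), ∃ U : TopologicalSpace.countableBasis X,
      (U.1 ∩ E η).Nonempty ∧ Disjoint U.1 (E (η + 1)) := by
    rintro ⟨η, hη⟩
    have hss : E (η + 1) ⊂ E η := by
      refine (antitone_iterDeriv A B le_self_add).ssubset_of_ne ?_
      have hD := h _ (isClosed_iterDeriv A B η) (hne η hη)
      rwa [← iterDeriv_add_one (deriv τ A B)] at hD
    obtain ⟨x, hx, hx'⟩ := Set.exists_of_ssubset hss
    obtain ⟨U, hU, hxU, hUE⟩ := (TopologicalSpace.isBasis_countableBasis X).exists_subset_of_mem_open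
      (show x ∈ (E (η + 1))ᶜ from hx') (isClosed_iterDeriv A B (η + 1)).isOpen_compl
    exact ⟨⟨U, hU⟩, ⟨x, hxU, hx⟩, Set.disjoint_left.2 hUE⟩
  choose U hU hU' using hstep
  have hlt : ∀ θ η, θ < η → U θ ≠ U η := by
    intro θ η hlt heq
    obtain ⟨x, hxU, hxE⟩ := hU η
    rw [← heq] at hxU
    exact Set.disjoint_left.1 (hU' θ) hxU
      (antitone_iterDeriv A B (Order.add_one_le_of_lt hlt) hxE)
  have hinj : Function.Injective U := by
    intro θ η heq
    rcases lt_trichotomy θ η with h | h | h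
    exacts [absurd heq (hlt _ _ h), h, absurd heq.symm (hlt _ _ h)]
  exact (lt_omega_one_iff_countable.2 (Set.countable_coe_iff.1 hinj.countable)).false

/-! ### Functions of Baire class one -/

/-- For `f = lim g n` this set is a `G_δ` lying between `{f < c}` and `{f ≤ c}`, as the category
argument needs. -/
theorem isGδ_setOf_frequently_lt {g : ℕ → X → ℝ} (hg : ∀ n, Continuous (g n)) (c : ℝ) :
    IsGδ {x | ∃ᶠ n in Filter.atTop, g n x < c} := by
  have : {x | ∃ᶠ n in Filter.atTop, g n x < c} =
      ⋂ N : ℕ, ⋃ (n : ℕ) (_ : N ≤ n), {x | g n x < c} := by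
    ext x
    simp [Filter.frequently_atTop]
  rw [this]
  exact .iInter_of_isOpen fun N => isOpen_biUnion fun n _ => isOpen_lt (hg n) continuous_const

theorem isGδ_setOf_frequently_gt {g : ℕ → X → ℝ} (hg : ∀ n, Continuous (g n)) (c : ℝ) :
    IsGδ {x | ∃ᶠ n in Filter.atTop, c < g n x} := by
  simpa [neg_lt_neg_iff] using isGδ_setOf_frequently_lt (fun n => (hg n).neg) (-c)

/-- If `D F = F`, both level sets are dense in `F`. With `p < r < s < q`, the points where `g n < r`
infinitely often and those where `s < g n` infinitely often are dense `G_δ` sets in the Polish space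
`F`. A common point would satisfy `s ≤ f x ≤ r`. -/
theorem IsBaireClass.deriv_ne [PolishSpace X] {f : X → ℝ} (hf : IsBaireClass τ 1 f) {p q : ℝ}
    (hpq : p < q) {F : Set X} (hF : IsClosed F) (hne : F.Nonempty) :
    deriv τ {x | f x ≤ p} {x | q ≤ f x} F ≠ F := by
  intro hD
  obtain ⟨g, hg, hlim⟩ := hf.exists_tendsto_continuous
  obtain ⟨r, hpr, hrq⟩ := exists_between hpq
  obtain ⟨s, hrs, hsq⟩ := exists_between hrq
  have : PolishSpace F := hF.polishSpace
  have : Nonempty F := hne.to_subtype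
  have hdense : ∀ {C G : Set X}, F ⊆ closure (F ∩ C) → C ⊆ G →
      Dense ((↑) ⁻¹' G : Set F) := by
    intro C G hC hCG x
    rw [closure_subtype]
    refine closure_mono ?_ (hC x.2)
    rintro y ⟨hyF, hyC⟩
    exact ⟨⟨y, hyF⟩, hCG hyC, rfl⟩
  have hA : Dense ((↑) ⁻¹' {x | ∃ᶠ n in Filter.atTop, g n x < r} : Set F) := by
    refine hdense (hD.symm.subset.trans Set.inter_subset_left) fun x hx => ?_
    exact ((hlim x).eventually_lt_const (lt_of_le_of_lt hx hpr)).frequently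
  have hB : Dense ((↑) ⁻¹' {x | ∃ᶠ n in Filter.atTop, s < g n x} : Set F) := by
    refine hdense (hD.symm.subset.trans Set.inter_subset_right) fun x hx => ?_
    exact ((hlim x).eventually_const_lt (lt_of_lt_of_le hsq hx)).frequently
  obtain ⟨x, hxA, hxB⟩ := (hA.inter_of_Gδ
    (isGδ_setOf_frequently_lt (fun n => (hg n).comp continuous_subtype_val) r)
    (isGδ_setOf_frequently_gt (fun n => (hg n).comp continuous_subtype_val) s) hB).nonempty
  exact (((le_of_tendsto_of_frequently (hlim x) (hxA.mono fun _ => le_of_lt)).trans_lt hrs).trans_le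
    (ge_of_tendsto_of_frequently (hlim x) (hxB.mono fun _ => le_of_lt))).false

theorem IsBaireClass.exists_iterDeriv_eq_empty [PolishSpace X] {f : X → ℝ}
    (hf : IsBaireClass τ 1 f) {p q : ℝ} (hpq : p < q) :
    ∃ η < ω₁, iterDeriv (deriv τ {x | f x ≤ p} {x | q ≤ f x}) Set.univ η = ∅ :=
  BaireRank.exists_iterDeriv_eq_empty fun _ hF hne => hf.deriv_ne hpq hF hne

theorem IsBaireClass.alpha_lt_omega_one [PolishSpace X] {f : X → ℝ} (hf : IsBaireClass τ 1 f) :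
    alpha τ f < ω₁ := by
  refine Ordinal.iSup_lt_omega_one fun r => ?_
  obtain ⟨η, hη, h⟩ := hf.exists_iterDeriv_eq_empty (Rat.cast_lt.2 r.2)
  exact (derivRank_le h).trans_lt hη

/-! ### Derivatives and transfinite differences -/

/-- At even `η`, the layer `F η \ F (η + 1)` misses `B`, so `F η ∩ B ⊆ F (η + 1)`. At other `η`, a
point of `A` in `F η` lies in an even layer, necessarily of index above `η`, hence in `F (η + 1)`.
Closedness absorbs the closures. -/
theorem iterDeriv_subset_of_separated {A B : Set X} {l : Ordinal.{0}} {F : Ordinal.{0} → Set X}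
    (hF : IsDecrContSeq l F) (hcl : ∀ η, η < l → IsClosed (F η)) (hA : A ⊆ transDiff l F)
    (hB : Disjoint (transDiff l F) B) (η : Ordinal.{0}) :
    iterDeriv (deriv τ A B) Set.univ η ⊆ F η := by
  have hcl' : ∀ η, IsClosed (F η) := fun η => by
    rcases lt_or_ge η l with h | h
    · exact hcl η h
    · rw [hF.eq_empty η h]
      exact isClosed_empty
  have hanti : ∀ θ η, θ ≤ η → F η ⊆ F θ := fun θ η h => by
    rcases lt_or_ge η l with hη | hη
    · exact hF.antitone θ η h hη
    · rw [hF.eq_empty η hη]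
      exact Set.empty_subset _
  induction η using Ordinal.limitRecOn with
  | zero => rw [hF.zero]; exact Set.subset_univ _
  | add_one η ih =>
    rw [iterDeriv_add_one]
    by_cases he : IsEvenOrdinal η
    · refine Set.inter_subset_right.trans ((hcl' _).closure_subset_iff.2 ?_)
      rintro x ⟨hx, hxB⟩
      by_contra hx'
      have hηl : η < l := by
        by_contra! h
        simpa [hF.eq_empty η h] using ih hx
      refine Set.disjoint_left.1 hB ?_ hxB
      simp only [transDiff, Set.mem_iUnion]
      exact ⟨η, hηl, he, ih hx, hx'⟩
    · refine Set.inter_subset_left.trans ((hcl' _).closure_subset_iff.2 ?_)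
      rintro x ⟨hx, hxA⟩
      have := hA hxA
      simp only [transDiff, Set.mem_iUnion] at this
      obtain ⟨θ, -, hθ, hxθ, hxθ'⟩ := this
      refine hanti (η + 1) θ ?_ hxθ
      refine Order.add_one_le_of_lt (lt_of_le_of_ne ?_ ?_)
      · by_contra! h
        exact hxθ' (hanti _ _ (Order.add_one_le_of_lt h) (ih hx))
      · rintro rfl
        exact he hθ
  | limit η hη ih =>
    rw [iterDeriv_limit _ _ hη]
    have hsub : ⋂ (θ : Ordinal.{0}) (_ : θ < η), iterDeriv (deriv τ A B) Set.univ θ ⊆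
        ⋂ (θ : Ordinal.{0}) (_ : θ < η), F θ := Set.iInter₂_mono ih
    -- Continuity is assumed only below `l`; at `l` itself `limit_length` replaces it.
    rcases lt_trichotomy η l with h | rfl | h
    · rwa [hF.continuous η h hη]
    · rw [hF.limit_length hη] at hsub
      exact hsub.trans (Set.empty_subset _)
    · refine hsub.trans ((Set.biInter_subset_of_mem h).trans ?_)
      rw [hF.eq_empty l le_rfl]
      exact Set.empty_subset _

theorem derivRank_le_of_separated {A B : Set X} {l : Ordinal.{0}} {F : Ordinal.{0} → Set X}
    (hF : IsDecrContSeq l F) (hcl : ∀ η, η < l → IsClosed (F η)) (hA : A ⊆ transDiff l F)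
    (hB : Disjoint (transDiff l F) B) : derivRank (deriv τ A B) ≤ l := by
  refine derivRank_le (Set.subset_empty_iff.1 ?_)
  rw [← hF.eq_empty l le_rfl]
  exact iterDeriv_subset_of_separated hF hcl hA hB l

open Classical in
/-- The sequence of closed sets which interleaves the iterated derivatives `D^ζ` with the closures
of the sets `D^ζ ∩ B`. -/
noncomputable def interleave (τ : TopologicalSpace X) (A B : Set X) (η : Ordinal.{0}) : Set X :=
  if η % 2 = 0 then iterDeriv (deriv τ A B) Set.univ (η / 2)
  else closure (iterDeriv (deriv τ A B) Set.univ (η / 2) ∩ B)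

theorem interleave_two_mul (A B : Set X) (ζ : Ordinal.{0}) :
    interleave τ A B (2 * ζ) = iterDeriv (deriv τ A B) Set.univ ζ := by
  rw [interleave, if_pos (Ordinal.mul_mod _ _), Ordinal.mul_div_cancel _ two_ne_zero]

theorem interleave_two_mul_add_one (A B : Set X) (ζ : Ordinal.{0}) :
    interleave τ A B (2 * ζ + 1) = closure (iterDeriv (deriv τ A B) Set.univ ζ ∩ B) := by
  rw [interleave, two_mul_add_one_mod_two, if_neg one_ne_zero, two_mul_add_one_div_two]

theorem interleave_subset (A B : Set X) (η : Ordinal.{0}) :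
    interleave τ A B η ⊆ iterDeriv (deriv τ A B) Set.univ (η / 2) := by
  rw [interleave]
  split_ifs
  · rfl
  · exact (isClosed_iterDeriv A B _).closure_subset_iff.2 Set.inter_subset_left

/-- With `interleave_subset`, this sandwiches every term between consecutive derivatives, which
yields monotonicity. -/
theorem iterDeriv_subset_interleave (A B : Set X) (η : Ordinal.{0}) :
    iterDeriv (deriv τ A B) Set.univ (η / 2 + 1) ⊆ interleave τ A B η := by
  rw [interleave]
  split_ifs
  · exact antitone_iterDeriv A B le_self_add
  · rw [iterDeriv_add_one]
    exact Set.inter_subset_right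

theorem isClosed_interleave (A B : Set X) (η : Ordinal.{0}) : IsClosed (interleave τ A B η) := by
  rw [interleave]
  split_ifs
  exacts [isClosed_iterDeriv A B _, isClosed_closure]

theorem antitone_interleave (A B : Set X) : Antitone (interleave τ A B) := by
  intro θ η h
  have hθ := Ordinal.div_add_mod θ 2
  have hη := Ordinal.div_add_mod η 2
  have hdiv : θ / 2 ≤ η / 2 := Ordinal.div_le_left h 2
  rcases hdiv.eq_or_lt with heq | hlt
  · rcases mod_two_eq θ with h0 | h1
    · refine (interleave_subset A B η).trans ?_
      rw [interleave, if_pos h0, heq]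
    · rcases mod_two_eq η with h0 | h1'
      · rw [heq, h1] at hθ
        rw [h0, add_zero] at hη
        rw [← hθ, ← hη] at h
        simp at h
      · rw [← hθ, ← hη, heq, h1, h1']
  · exact (interleave_subset A B η).trans ((antitone_iterDeriv A B
      (Order.add_one_le_of_lt hlt)).trans (iterDeriv_subset_interleave A B θ))

theorem interleave_limit (A B : Set X) {η : Ordinal.{0}} (hη : Order.IsSuccLimit η) :
    interleave τ A B η = ⋂ (θ : Ordinal.{0}) (_ : θ < η), interleave τ A B θ := by
  refine (Set.subset_iInter₂ fun θ h => antitone_interleave A B h.le).antisymm ?_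
  obtain ⟨ζ, hζ, rfl⟩ := exists_isSuccLimit_eq_two_mul hη
  rw [interleave_two_mul, iterDeriv_limit _ _ hζ]
  refine Set.subset_iInter₂ fun k hk => ?_
  rw [← interleave_two_mul]
  exact Set.biInter_subset_of_mem ((mul_lt_mul_iff_right₀ two_pos).2 hk)

theorem isDecrContSeq_interleave {A B : Set X} {l : Ordinal.{0}}
    (h : iterDeriv (deriv τ A B) Set.univ l = ∅) :
    IsDecrContSeq (2 * l) (interleave τ A B) where
  zero := by rw [← mul_zero 2, interleave_two_mul, iterDeriv_zero]
  antitone _ _ hle _ := antitone_interleave A B hle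
  continuous _ _ hη := interleave_limit A B hη
  limit_length hl := by rw [← interleave_limit A B hl, interleave_two_mul, h]
  eq_empty η hη := by
    rw [← Set.subset_empty_iff, ← h, ← interleave_two_mul]
    exact antitone_interleave A B hη

/-- Each `x` leaves the derivatives at a successor stage: `x ∈ D^k \ D^(k+1)`. If `x ∈ A`, the
closure of `D^k ∩ A` contains `x`, so that of `D^k ∩ B` cannot. -/
theorem subset_transDiff_interleave {A B : Set X} {l : Ordinal.{0}}
    (h : iterDeriv (deriv τ A B) Set.univ l = ∅) :
    A ⊆ transDiff (2 * l) (interleave τ A B) := by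
  intro x hxA
  obtain ⟨k, hk, hk'⟩ : ∃ k, x ∈ iterDeriv (deriv τ A B) Set.univ k ∧
      x ∉ iterDeriv (deriv τ A B) Set.univ (k + 1) := by
    by_contra! hstep
    have hall : ∀ η, x ∈ iterDeriv (deriv τ A B) Set.univ η := by
      intro η
      induction η using Ordinal.limitRecOn with
      | zero => simp [iterDeriv_zero]
      | add_one η ih => exact hstep η ih
      | limit η hη ih =>
        rw [iterDeriv_limit _ _ hη]
        exact Set.mem_iInter₂.2 ih
    simpa [h] using hall l
  have hkl : k < l := by
    by_contra! hle
    simpa [h] using antitone_iterDeriv A B hle hk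
  simp only [transDiff, Set.mem_iUnion]
  refine ⟨2 * k, (mul_lt_mul_iff_right₀ two_pos).2 hkl, ⟨k, rfl⟩, ?_⟩
  rw [interleave_two_mul, interleave_two_mul_add_one]
  refine ⟨hk, fun hx => hk' ?_⟩
  rw [iterDeriv_add_one]
  exact ⟨subset_closure ⟨hk, hxA⟩, hx⟩

theorem disjoint_transDiff_interleave (A B : Set X) (l : Ordinal.{0}) :
    Disjoint (transDiff l (interleave τ A B)) B := by
  refine Set.disjoint_left.2 fun x hx hxB => ?_
  simp only [transDiff, Set.mem_iUnion] at hx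
  obtain ⟨_, -, ⟨ζ, rfl⟩, hx, hx'⟩ := hx
  rw [interleave_two_mul] at hx
  rw [interleave_two_mul_add_one] at hx'
  exact hx' (subset_closure ⟨hx, hxB⟩)

/-! ### Comparison of the ranks -/

theorem exists_separatedByDiff_le_two_mul_alpha [PolishSpace X] {ξ : Ordinal.{0}} {f : X → ℝ}
    {τ' : TopologicalSpace X} (hτ' : τ' ∈ refinements τ ξ f) (r : RatPair) :
    ∃ l ≤ 2 * alpha τ' f,
      SeparatedByDiff τ ξ {x | f x ≤ (r.1.1 : ℝ)} {x | (r.1.2 : ℝ) ≤ f x} l := by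
  obtain ⟨-, hP, hS, hB⟩ := hτ'
  obtain ⟨η, -, hη⟩ := @IsBaireClass.exists_iterDeriv_eq_empty X τ' hP f hB _ _ (Rat.cast_lt.2 r.2)
  have h := iterDeriv_derivRank ⟨η, hη⟩
  refine ⟨_, ?_, interleave τ' _ _, isDecrContSeq_interleave h, fun θ _ => ?_,
    subset_transDiff_interleave h, disjoint_transDiff_interleave _ _ _⟩
  · exact mul_le_mul_right (Ordinal.le_iSup (fun r : RatPair => derivRank
      (deriv τ' {x | f x ≤ (r.1.1 : ℝ)} {x | (r.1.2 : ℝ) ≤ f x})) r) 2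
  · exact hS _ (isClosed_interleave _ _ θ).isOpen_compl

theorem alphaXi_le_two_mul_alpha [PolishSpace X] {ξ : Ordinal.{0}} {f : X → ℝ}
    {τ' : TopologicalSpace X} (hτ' : τ' ∈ refinements τ ξ f) :
    alphaXi τ ξ f ≤ 2 * alpha τ' f := by
  refine Ordinal.iSup_le fun r => ?_
  obtain ⟨l, hl, hs⟩ := exists_separatedByDiff_le_two_mul_alpha (τ := τ) hτ' r
  exact (alphaXiSets_le hs).trans hl

theorem alphaXi_lt_omega_one [PolishSpace X] {ξ : Ordinal.{0}} {f : X → ℝ}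
    {τ' : TopologicalSpace X} (hτ' : τ' ∈ refinements τ ξ f) : alphaXi τ ξ f < ω₁ := by
  have h : alpha τ' f < ω₁ := @IsBaireClass.alpha_lt_omega_one X τ' hτ'.2.1 f hτ'.2.2.2
  exact (alphaXi_le_two_mul_alpha (τ := τ) hτ').trans_lt (mul_lt_omega_one
    ((by exact_mod_cast Ordinal.natCast_lt_omega0 2 : (2 : Ordinal.{0}) < ω).trans
      Ordinal.omega0_lt_omega_one) h)

theorem exists_alpha_le_alphaXi [PolishSpace X] {ξ : Ordinal.{0}} (hξ : 1 ≤ ξ) {f : X → ℝ}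
    (hf : IsBaireClass τ ξ f) : ∃ τ' ∈ refinements τ ξ f, alpha τ' f ≤ alphaXi τ ξ f := by
  -- A preliminary refinement, with no sets prescribed, shows that separating sequences exist and
  -- have countable length. Only then is the family to be made closed known to be countable.
  obtain ⟨τ₀, hτ₀, -⟩ := exists_mem_refinements (τ := τ) (ι := Empty) hξ hf (C := Empty.elim)
    (by rintro ⟨⟩)
  let l : RatPair → Ordinal.{0} := fun r =>
    alphaXiSets τ ξ {x | f x ≤ (r.1.1 : ℝ)} {x | (r.1.2 : ℝ) ≤ f x}
  have hle : ∀ r, l r ≤ alphaXi τ ξ f := Ordinal.le_iSup l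
  have hsep : ∀ r, SeparatedByDiff τ ξ {x | f x ≤ (r.1.1 : ℝ)} {x | (r.1.2 : ℝ) ≤ f x} (l r) := by
    intro r
    obtain ⟨k, -, hk⟩ := exists_separatedByDiff_le_two_mul_alpha (τ := τ) hτ₀ r
    exact separatedByDiff_alphaXiSets ⟨k, hk⟩
  choose F hF hPi hA hB using hsep
  have (r : RatPair) : Countable (Set.Iio (l r)) :=
    lt_omega_one_iff_countable.1 ((hle r).trans_lt (alphaXi_lt_omega_one (τ := τ) hτ₀))
  obtain ⟨τ', hτ', hO⟩ := exists_mem_refinements (τ := τ) (ι := Σ r : RatPair, Set.Iio (l r)) hξ hf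
    (C := fun i => (F i.1 i.2)ᶜ) fun i => hPi i.1 _ i.2.2
  refine ⟨τ', hτ', Ordinal.iSup_le fun r => le_trans ?_ (hle r)⟩
  exact @derivRank_le_of_separated X τ' _ _ _ _ (hF r)
    (fun η hη => @IsClosed.mk X τ' _ (hO ⟨r, η, hη⟩)) (hA r) (hB r)

end BaireRank

theorem mainTheorem7 {X : Type*} [τ : TopologicalSpace X] [PolishSpace X] [Uncountable X]
    (ξ : Ordinal.{0}) (hξ1 : 1 ≤ ξ) (hξ : ξ < ω₁)
    (f : X → ℝ) (hf : BaireRank.IsBaireClass τ ξ f) :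
    (BaireRank.refinements τ ξ f).Nonempty ∧
    BaireRank.alphaXi τ ξ f < ω₁ ∧
    BaireRank.alphaStar τ ξ f ≤ BaireRank.alphaXi τ ξ f ∧
    BaireRank.alphaXi τ ξ f ≤ 2 * BaireRank.alphaStar τ ξ f ∧
    BaireRank.EssEq (BaireRank.alphaStar τ ξ f) (BaireRank.alphaXi τ ξ f) := by
  obtain ⟨τ', hτ', hle⟩ := BaireRank.exists_alpha_le_alphaXi hξ1 hf
  have h1 : BaireRank.alphaStar τ ξ f ≤ BaireRank.alphaXi τ ξ f :=
    (csInf_le' (Set.mem_image_of_mem _ hτ')).trans hle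
  have h2 : BaireRank.alphaXi τ ξ f ≤ 2 * BaireRank.alphaStar τ ξ f := by
    -- The infimum is attained, ordinals being well-ordered.
    obtain ⟨τ'', hτ'', heq⟩ := csInf_mem (Set.Nonempty.image
      (fun τ' => BaireRank.alpha τ' f) ⟨τ', hτ'⟩)
    rw [BaireRank.alphaStar, ← heq]
    exact BaireRank.alphaXi_le_two_mul_alpha (τ := τ) hτ''
  exact ⟨⟨τ', hτ'⟩, BaireRank.alphaXi_lt_omega_one (τ := τ) hτ', h1, h2,
    BaireRank.essEq_of_le_of_le_two_mul h1 h2⟩
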